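/- Let $G=(V,E)$ be a finite simple graph. **Preposets over $G$.** For an acyclic orientation $\omega$ of $G$, let $P=P(G,\omega)$ be the poset on $V$ with $i\le_P j$ iff $\omega$ has a directed path from $i$ to $j$. For a partition $\pi$ of $V$ write $i\sim_\pi j$ if $i,j$ lie in the same block, let $D_\pi=\{x\in\mathbb R^V: x_i=x_j \text{ whenever } i\sim_\pi j\}$, and let $P_\pi$ be the preposet on the blocks of $\pi$ generated by $B\le B'$ whenever $b\le_P b'$ for some $b\in B$, $b'\in B'$. Call $\pi$ a closed face partition of $P$ if $D_\pi$ is an intersection of (possibly no) hyperplanes $\{x_i=x_j\}$ with $i\neq j$ comparable in $P$, and $P_\pi$ is a poset. Let $\omega_\pi$ be the orientation of $G$ (bidirected edges allowed) in which the edge $\{i,j\}$ is directed $i\to j$ iff $i\le_P j$ or $i\sim_\pi j$. Let $\mathrm{Pre}(G)$ be the set of all $\omega_\pi$, with $\omega$ an acyclic orientation of $G$ and $\pi$ a closed face partition of $P(G,\omega)$. Let $\equiv$ be the equivalence relation on $\mathrm{Pre}(G)$ generated by flips: $\tau,\tau'\in\mathrm{Pre}(G)$ differ by a flip if they have the same strongly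 connected components and the acyclic digraph obtained from $\tau'$ by collapsing these components arises from the one obtained from $\tau$ by converting one source into a sink. **Open faces.** For $\{i,j\}\in E$ let $H^{\mathrm{tor}}_{ij}=\{x\in\mathbb R^V/\mathbb Z^V: x_i=x_j\}$. A toric flat is an intersection of (possibly no) sets $H^{\mathrm{tor}}_{ij}$, $\{i,j\}\in E$. The open faces of the toric graphic arrangement $\mathcal A_{\mathrm{tor}}(G)$ are the chambers of the arrangements induced on its toric flats: the connected components of the sets $D\setminus\bigcup\{H^{\mathrm{tor}}_{ij}:\{i,j\}\in E,\ D\not\subseteq H^{\mathrm{tor}}_{ij}\}$, where $D$ is a toric flat. Let $\mathrm{Faces}\,\mathcal A_{\mathrm{tor}}(G)$ be the set of open faces. **The map.** For $x\in\mathbb R^V/\mathbb Z^V$ let $\bar\alpha_G(x)=\omega(x)$ be the directed graph on $V$ that has the edge $i\to j$ iff $\{i,j\}\in E$ and $(x_i \bmod 1)\le(x_j\bmod 1)$, with representatives in $[0,1)$. **Proposition.** For every $x\in\mathbb R^V/\mathbb Z^V$, $\omega(x)\in\mathrm{Pre}(G)$ and $x$ lies on exactly one open face of $\mathcal A_{\mathrm{tor}}(G)$.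 The map $\bar\alpha_G$ induces a bijection from $\mathrm{Faces}\,\mathcal A_{\mathrm{tor}}(G)$ to $\mathrm{Pre}(G)/{\equiv}$, which sends an open face $F$ to the class of $\omega(x)$ for any $x\in F$. In other words, for all $x,x'\in\mathbb R^V/\mathbb Z^V$, $\omega(x)\equiv\omega(x')$ if and only if $x$ and $x'$ lie on the same open face of $\mathcal A_{\mathrm{tor}}(G)$. -/

import Mathlib

open Set Relation

section Flats

variable {V : Type*}

/-- The hyperplane `x i = x j` in `T ^ V`: for `T = ℝ` this is the hyperplane `H_ij` of `ℝ ^ V`, and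
for `T = ℝ/ℤ` it is the toric hyperplane `H_ij` of the torus `(ℝ/ℤ) ^ V = ℝ ^ V / ℤ ^ V`. -/
def coordHyperplane (T : Type*) (i j : V) : Set (V → T) := {x | x i = x j}

/-- `D` is a flat of the arrangement of all hyperplanes `x i = x j` with `{i, j}` an edge of `G`:
an intersection of some of these hyperplanes.  The empty intersection is the whole space.
(Each such intersection contains the diagonal points, so it is not empty.) -/
def IsFlat (T : Type*) (G : SimpleGraph V) (D : Set (V → T)) : Prop :=
  ∃ S : Set (V × V), (∀ p ∈ S, G.Adj p.1 p.2) ∧ D = ⋂ p ∈ S, coordHyperplane T p.1 p.2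

/-- The subspace `D_π` attached to a partition `π` of `V` (the partition into the classes of the
equivalence relation `π`): all `x` whose coordinates are constant on every block. -/
def partitionSubspace (T : Type*) (π : Setoid V) : Set (V → T) := {x | ∀ i j, π i j → x i = x j}

end Flats

section Preposets

variable {V : Type*}

/-- Acyclic orientations of `G`; `ω i j` means that the edge `{i, j}` is directed `i → j`.
Acyclicity excludes in particular that both `i → j` and `j → i` hold. -/
structure IsAcyclicOrientation (G : SimpleGraph V) (ω : V → V → Prop) : Prop where
  adj_of_edge : ∀ i j, ω i j → G.Adj i j
  edge_of_adj : ∀ i j, G.Adj i j → ω i j ∨ ω j i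
  acyclic : ∀ i, ¬ TransGen ω i i

/-- The relation `i ≤ j` of the (pre)poset determined by a directed graph `ω`: there is a directed
path, possibly of length zero, from `i` to `j`. -/
def pathLE (ω : V → V → Prop) (i j : V) : Prop := ReflTransGen ω i j

/-- The graph of the transitive closure of the poset of `ω`: all pairs of distinct comparable
vertices. -/
def comparabilityGraph (ω : V → V → Prop) : SimpleGraph V := SimpleGraph.fromRel (pathLE ω)

/-- The preposet `P_π` on the blocks of `π`, written as a relation between representatives of the
blocks: the transitive closure of "some element of the first block is `≤` some element of the second
block". -/
def blockLE (ω : V → V → Prop) (π : Setoid V) (i j : V) : Prop :=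
  ReflTransGen (fun a b => ∃ a' b', π a a' ∧ pathLE ω a' b' ∧ π b' b) i j

/-- The closure of the partition `π` with respect to the poset of `ω`: merge all pairs of blocks that
are `≤` each other in `P_π`. -/
def closurePartition (ω : V → V → Prop) (π : Setoid V) : Setoid V where
  r i j := blockLE ω π i j ∧ blockLE ω π j i
  iseqv := ⟨fun _ => ⟨ReflTransGen.refl, ReflTransGen.refl⟩, fun h => ⟨h.2, h.1⟩,
    fun h k => ⟨h.1.trans k.1, k.2.trans h.2⟩⟩

/-- `π` is a closed face partition of the poset of `ω`: `D_π` is a flat of the graphic arrangement of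
the transitive closure, and `π` is equal to its closure (that is, `P_π` is acyclic). -/
def IsClosedFacePartition (ω : V → V → Prop) (π : Setoid V) : Prop :=
  IsFlat ℝ (comparabilityGraph ω) (partitionSubspace ℝ π) ∧ closurePartition ω π = π

/-- The orientation `ω_π` of `G`, with bidirected edges allowed: the edge `{i, j}` is directed
`i → j` if `i ≤ j` in the poset of `ω`, and it is directed both ways if `i` and `j` lie in the same
block of `π`. -/
def orientationMod (G : SimpleGraph V) (ω : V → V → Prop) (π : Setoid V) (i j : V) : Prop :=
  G.Adj i j ∧ (pathLE ω i j ∨ π i j)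

/-- `Pre(G)`: the preposets over `G`. -/
def Pre (G : SimpleGraph V) : Set (V → V → Prop) :=
  {τ | ∃ (ω : V → V → Prop) (π : Setoid V),
    IsAcyclicOrientation G ω ∧ IsClosedFacePartition ω π ∧ τ = orientationMod G ω π}

/-- The partition of `V` into the strongly connected components of the directed graph `τ`. -/
def strongComponents (τ : V → V → Prop) : Setoid V where
  r i j := pathLE τ i j ∧ pathLE τ j i
  iseqv := ⟨fun _ => ⟨ReflTransGen.refl, ReflTransGen.refl⟩, fun h => ⟨h.2, h.1⟩,
    fun h k => ⟨h.1.trans k.1, k.2.trans h.2⟩⟩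

/-- The edges `B → C` of the acyclic quotient of `τ`, whose vertices are the strongly connected
components of `τ`. -/
def quotientEdge (τ : V → V → Prop) (B C : Set V) : Prop :=
  B ∈ (strongComponents τ).classes ∧ C ∈ (strongComponents τ).classes ∧ B ≠ C ∧
    ∃ i ∈ B, ∃ j ∈ C, τ i j

/-- The acyclic quotients of `τ` and `τ'` have the same vertices and differ only by converting a
source `B` of the first one into a sink: the edges at `B` are reversed and all others are kept. -/
def IsFlip (τ τ' : V → V → Prop) : Prop :=
  strongComponents τ = strongComponents τ' ∧
  ∃ B ∈ (strongComponents τ).classes, (∀ C, ¬ quotientEdge τ C B) ∧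
    (∀ C D, C = B ∨ D = B → (quotientEdge τ' C D ↔ quotientEdge τ D C)) ∧
    (∀ C D, C ≠ B → D ≠ B → (quotientEdge τ' C D ↔ quotientEdge τ C D))

/-- Toric equivalence `≡` on `Pre(G)`: the equivalence relation generated by flips (source to sink;
the inverse operation, sink to source, is included by symmetry). -/
def toricEquiv (G : SimpleGraph V) : Setoid (Pre G) :=
  EqvGen.setoid (fun τ τ' : Pre G => IsFlip τ.1 τ'.1)

end Preposets

section Torus

variable {V : Type*}

/-- The representative in `[0, 1)` of a point of `ℝ/ℤ`. -/
noncomputable def modOne (t : UnitAddCircle) : ℝ := (AddCircle.equivIco (1 : ℝ) 0 t : ℝ)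

/-- The directed graph `ω(x)` of a point `x` of the torus: for each edge `{i, j}` of `G` it has the
edge `i → j` if `x i mod 1 ≤ x j mod 1`. -/
def toricOmega (G : SimpleGraph V) (x : V → UnitAddCircle) (i j : V) : Prop :=
  G.Adj i j ∧ modOne (x i) ≤ modOne (x j)

/-- The complement, in a subset `D` of the torus, of all toric hyperplanes of `G` that do not contain
`D`; for a toric flat `D` this is the complement of the arrangement that the toric graphic
arrangement of `G` induces on `D`. -/
def flatComplement (G : SimpleGraph V) (D : Set (V → UnitAddCircle)) : Set (V → UnitAddCircle) :=
  {x ∈ D | ∀ i j, G.Adj i j → ¬ D ⊆ coordHyperplane UnitAddCircle i j →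
    x ∉ coordHyperplane UnitAddCircle i j}

/-- The open faces of the toric graphic arrangement of `G`: the chambers of the arrangements that it
induces on its toric flats `D`, that is, the connected components of the complements above.  For `D`
the whole torus these are the toric chambers of `G`. -/
def toricFaces (G : SimpleGraph V) : Set (Set (V → UnitAddCircle)) :=
  {F | ∃ D, IsFlat UnitAddCircle G D ∧
    ∃ x ∈ flatComplement G D, F = connectedComponentIn (flatComplement G D) x}

end Torus

/-! ### Digraphs of real potentials and their strong components. -/

section PotentialDigraph

variable {V : Type*}

/-! With representatives in `[0, 1)`, `ω(x)` is the digraph of the potential `modOne ∘ x`. The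
digraphs of real potentials are exactly the elements of `Pre G` (`potentialDigraph_mem_Pre`,
`exists_potential_of_mem_Pre`), and potentials in `[0, 1)` suffice, so every element of `Pre G` is
some `ω(x)`. On the other side, an open face is a connected component of a stratum, the set of
points lying on the same toric hyperplanes (`flatComplement_eq_toricStratum`).

Equivalent digraphs give the same face: points with equal digraphs are joined by a straight segment
of representatives, and a flip is realized by pushing the source component down through `0`, so that
it reappears just below `1` (`toricFace_eq_of_isFlip`).

Conversely, when a point moves slightly inside its stratum, only coordinates equal to `0` can wrap
around. Up to the choice of potential this lifts an initial set of vertices by `1`, which is a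
sequence of flips (`toricEquiv_raise`). Hence the class of `ω` is locally constant on strata
(`eventually_toricEquiv`) and constant on faces. -/

/-- The digraph on the edges of `G` directed along which the potential `h` weakly increases. -/
def potentialDigraph (G : SimpleGraph V) (h : V → ℝ) (i j : V) : Prop :=
  G.Adj i j ∧ h i ≤ h j

theorem potential_le_of_pathLE {G : SimpleGraph V} {h : V → ℝ} {i j : V}
    (hp : pathLE (potentialDigraph G h) i j) : h i ≤ h j := by
  induction hp with
  | refl => exact le_rfl
  | tail _ hbc ih => exact ih.trans hbc.2

/-- The potential never decreases along a path, so it is constant on a closed walk. -/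
theorem strongComponents_potentialDigraph_iff {G : SimpleGraph V} {h : V → ℝ} {i j : V} :
    strongComponents (potentialDigraph G h) i j ↔
      ReflTransGen (fun a b => G.Adj a b ∧ h a = h b) i j := by
  constructor
  · rintro ⟨hij, hji⟩
    induction hij using ReflTransGen.head_induction_on with
    | refl => exact ReflTransGen.refl
    | @head a c hac hcj ih =>
      refine ReflTransGen.head ⟨hac.1, hac.2.antisymm ?_⟩ (ih (hji.tail hac))
      exact (potential_le_of_pathLE hcj).trans (potential_le_of_pathLE hji)
  · intro hp
    induction hp with
    | refl => exact ⟨ReflTransGen.refl, ReflTransGen.refl⟩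
    | tail _ hbc ih =>
      exact ⟨ih.1.tail ⟨hbc.1, hbc.2.le⟩, ih.2.head ⟨hbc.1.symm, hbc.2.ge⟩⟩

theorem potential_eq_of_strongComponents {G : SimpleGraph V} {h : V → ℝ} {i j : V}
    (hp : strongComponents (potentialDigraph G h) i j) : h i = h j :=
  (potential_le_of_pathLE hp.1).antisymm (potential_le_of_pathLE hp.2)

theorem strongComponents_of_adj_of_eq {G : SimpleGraph V} {h : V → ℝ} {i j : V}
    (hij : G.Adj i j) (he : h i = h j) : strongComponents (potentialDigraph G h) i j :=
  strongComponents_potentialDigraph_iff.2 (ReflTransGen.single ⟨hij, he⟩)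

theorem strongComponents_potentialDigraph_congr {G : SimpleGraph V} {h k : V → ℝ}
    (hk : ∀ i j, G.Adj i j → (h i = h j ↔ k i = k j)) :
    strongComponents (potentialDigraph G h) = strongComponents (potentialDigraph G k) := by
  ext i j
  have : (fun a b => G.Adj a b ∧ h a = h b) = fun a b => G.Adj a b ∧ k a = k b := by
    ext a b
    exact and_congr_right (hk a b)
  rw [strongComponents_potentialDigraph_iff, strongComponents_potentialDigraph_iff, this]

/-- The classes of the strong components are closed under equal-potential edges. -/
theorem mem_of_adj_of_eq {G : SimpleGraph V} {h : V → ℝ} {B : Set V}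
    (hB : B ∈ (strongComponents (potentialDigraph G h)).classes) {i j : V}
    (hi : i ∈ B) (hij : G.Adj i j) (he : h i = h j) : j ∈ B := by
  obtain ⟨c, rfl⟩ := hB
  exact Setoid.trans' _ (Setoid.symm' _ (strongComponents_of_adj_of_eq hij he)) hi

/-- One-way implications suffice: a failing weak inequality is a strict one on the reversed edge. -/
theorem potentialDigraph_congr {G : SimpleGraph V} {h k : V → ℝ}
    (hlt : ∀ i j, G.Adj i j → h i < h j → k i < k j)
    (heq : ∀ i j, G.Adj i j → h i = h j → k i = k j) :
    potentialDigraph G h = potentialDigraph G k := by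
  ext i j
  refine and_congr_right fun hij => ⟨fun hl => ?_, fun hl => ?_⟩
  · rcases hl.lt_or_eq with hl | hl
    · exact (hlt i j hij hl).le
    · exact (heq i j hij hl).le
  · by_contra! hc
    exact hl.not_gt (hlt j i hij.symm hc)

theorem potentialDigraph_lt {G : SimpleGraph V} {h k : V → ℝ}
    (e : potentialDigraph G h = potentialDigraph G k) {i j : V} (hij : G.Adj i j)
    (hl : h i < h j) : k i < k j := by
  by_contra! hc
  have : potentialDigraph G h j i := by rw [e]; exact ⟨hij.symm, hc⟩
  exact this.2.not_gt hl

theorem potentialDigraph_eq {G : SimpleGraph V} {h k : V → ℝ}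
    (e : potentialDigraph G h = potentialDigraph G k) {i j : V} (hij : G.Adj i j)
    (he : h i = h j) : k i = k j := by
  have h1 : potentialDigraph G k i j := by rw [← e]; exact ⟨hij, he.le⟩
  have h2 : potentialDigraph G k j i := by rw [← e]; exact ⟨hij.symm, he.ge⟩
  exact h1.2.antisymm h2.2

/-! ### Elements of `Pre G` as digraphs of potentials. -/

theorem exists_injective_nat [Finite V] : ∃ f : V → ℕ, Function.Injective f := by
  obtain ⟨n, ⟨e⟩⟩ := Finite.exists_equiv_fin V
  exact ⟨fun i => e i, fun i j hij => e.injective (Fin.ext hij)⟩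

theorem potentialDigraph_mem_Pre [Finite V] (G : SimpleGraph V) (h : V → ℝ) :
    potentialDigraph G h ∈ Pre G := by
  obtain ⟨f, hf⟩ := exists_injective_nat (V := V)
  -- Ties of `h` are broken by the numbering `f`; the lexicographic order makes `ω` acyclic.
  let ω : V → V → Prop := fun i j => G.Adj i j ∧ (h i < h j ∨ h i = h j ∧ f i < f j)
  have hsub : ∀ {i j}, pathLE ω i j → pathLE (potentialDigraph G h) i j := by
    intro i j hp
    refine ReflTransGen.mono ?_ _ _ hp
    intro a b hab
    exact ⟨hab.1, hab.2.elim le_of_lt fun h => h.1.le⟩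
  refine ⟨ω, strongComponents (potentialDigraph G h), ⟨fun i j hij => hij.1, ?_, ?_⟩,
    ⟨?_, ?_⟩, ?_⟩
  · intro i j hij
    have hne : f i ≠ f j := fun e => hij.ne (hf e)
    rcases lt_trichotomy (h i) (h j) with hl | he | hl
    · exact Or.inl ⟨hij, Or.inl hl⟩
    · rcases hne.lt_or_gt with hl | hl
      · exact Or.inl ⟨hij, Or.inr ⟨he, hl⟩⟩
      · exact Or.inr ⟨hij.symm, Or.inr ⟨he.symm, hl⟩⟩
    · exact Or.inr ⟨hij.symm, Or.inl hl⟩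
  · intro i hi
    have key : ∀ j, TransGen ω i j → h i < h j ∨ h i = h j ∧ f i < f j := by
      intro j hj
      induction hj with
      | single hb => exact hb.2
      | tail _ hbc ih =>
        rcases ih with ih | ih <;> rcases hbc.2 with hl | hl
        · exact Or.inl (ih.trans hl)
        · exact Or.inl (ih.trans_eq hl.1)
        · exact Or.inl (ih.1.trans_lt hl)
        · exact Or.inr ⟨ih.1.trans hl.1, ih.2.trans hl.2⟩
    rcases key i hi with hl | hl
    · exact lt_irrefl _ hl
    · exact lt_irrefl _ hl.2
  · refine ⟨{p | G.Adj p.1 p.2 ∧ h p.1 = h p.2}, ?_, ?_⟩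
    · rintro ⟨i, j⟩ ⟨hij, he⟩
      have hne : f i ≠ f j := fun e => hij.ne (hf e)
      refine (SimpleGraph.fromRel_adj _ _ _).2 ⟨hij.ne, ?_⟩
      rcases hne.lt_or_gt with hl | hl
      · exact Or.inl (ReflTransGen.single ⟨hij, Or.inr ⟨he, hl⟩⟩)
      · exact Or.inr (ReflTransGen.single ⟨hij.symm, Or.inr ⟨he.symm, hl⟩⟩)
    · ext x
      simp only [partitionSubspace, coordHyperplane, mem_ofPred_eq, mem_iInter]
      constructor
      · rintro hx ⟨i, j⟩ ⟨hij, he⟩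
        exact hx i j (strongComponents_of_adj_of_eq hij he)
      · intro hx i j hij
        rw [strongComponents_potentialDigraph_iff] at hij
        induction hij with
        | refl => rfl
        | tail _ hbc ih => exact ih.trans (hx (_, _) hbc)
  · have hblock : ∀ {i j}, blockLE ω (strongComponents (potentialDigraph G h)) i j →
        pathLE (potentialDigraph G h) i j := by
      intro i j hb
      induction hb with
      | refl => exact ReflTransGen.refl
      | tail _ hbc ih =>
        obtain ⟨a, b, h1, h2, h3⟩ := hbc
        exact ((ih.trans h1.1).trans (hsub h2)).trans h3.1
    ext i j
    constructor
    · exact fun hij => ⟨hblock hij.1, hblock hij.2⟩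
    · exact fun hij => ⟨ReflTransGen.single ⟨j, j, hij, ReflTransGen.refl, Setoid.refl' _ j⟩,
        ReflTransGen.single ⟨j, j, Setoid.refl' _ j, ReflTransGen.refl, Setoid.symm' _ hij⟩⟩
  · ext i j
    refine and_congr_right fun hij => ⟨fun hl => ?_, fun hl => ?_⟩
    · rcases hl.lt_or_eq with hl | hl
      · exact Or.inl (ReflTransGen.single ⟨hij, Or.inl hl⟩)
      · exact Or.inr (strongComponents_of_adj_of_eq hij hl)
    · rcases hl with hl | hl
      · exact potential_le_of_pathLE (hsub hl)
      · exact (potential_eq_of_strongComponents hl).le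

/-- The potential of a vertex is the number of vertices from which it can be reached, rescaled. -/
theorem exists_potential_of_mem_Pre [Finite V] {G : SimpleGraph V} {τ : V → V → Prop}
    (hτ : τ ∈ Pre G) : ∃ h : V → ℝ, (∀ i, h i ∈ Ico (0 : ℝ) 1) ∧ τ = potentialDigraph G h := by
  obtain ⟨ω, π, hω, hπ, rfl⟩ := hτ
  have hblock : ∀ {i j}, pathLE (orientationMod G ω π) i j → blockLE ω π i j := by
    intro i j hp
    refine ReflTransGen.mono ?_ _ _ hp
    intro a b hab
    rcases hab.2 with hl | hl
    · exact ⟨a, b, π.refl' a, hl, π.refl' b⟩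
    · exact ⟨b, b, hl, ReflTransGen.refl, π.refl' b⟩
  -- The extra `1` keeps the rescaled potential strictly below `1`.
  let N : ℕ := Nat.card V + 1
  let d : V → Set V := fun i => {k | pathLE (orientationMod G ω π) k i}
  have hN : (0 : ℝ) < N := by positivity
  have hmono : ∀ {i j}, orientationMod G ω π i j → d i ⊆ d j := fun hij k hk => hk.tail hij
  refine ⟨fun i => (d i).ncard / N, fun i => ⟨by positivity, ?_⟩, ?_⟩
  · rw [div_lt_one hN]
    exact_mod_cast Nat.lt_succ_of_le (Set.ncard_le_card (d i))
  · ext i j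
    simp only [potentialDigraph, div_le_div_iff_of_pos_right hN, Nat.cast_le]
    constructor
    · exact fun hij => ⟨hij.1, Set.ncard_le_ncard (hmono hij) (Set.toFinite _)⟩
    · rintro ⟨hij, hl⟩
      by_contra hn
      have hji : orientationMod G ω π j i := by
        refine ⟨hij.symm, ?_⟩
        rcases hω.edge_of_adj i j hij with he | he
        · exact (hn ⟨hij, Or.inl (ReflTransGen.single he)⟩).elim
        · exact Or.inl (ReflTransGen.single he)
      -- Nested down-sets with the opposite inequality of sizes coincide. So `i` and `j` reach each
      -- other, and closedness of `π` puts them in one block.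
      have hd : d j = d i := Set.eq_of_subset_of_ncard_le (hmono hji) hl (Set.toFinite _)
      have hi : i ∈ d j := by rw [hd]; exact ReflTransGen.refl
      have hc : closurePartition ω π i j := ⟨hblock hi, hblock (ReflTransGen.single hji)⟩
      rw [hπ.2] at hc
      exact hn ⟨hij, Or.inr hc⟩

/-! ### Flips as lifts of strong components. -/

/-- Between strong components, the quotient of a potential digraph has the edges of the digraph. -/
theorem quotientEdge_potentialDigraph_iff {G : SimpleGraph V} {h : V → ℝ} {B C : Set V}
    (hB : B ∈ (strongComponents (potentialDigraph G h)).classes)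
    (hC : C ∈ (strongComponents (potentialDigraph G h)).classes) (hBC : B ≠ C) {i j : V}
    (hi : i ∈ B) (hj : j ∈ C) (hij : G.Adj i j) :
    quotientEdge (potentialDigraph G h) B C ↔ h i ≤ h j := by
  have hconst : ∀ {D : Set V}, D ∈ (strongComponents (potentialDigraph G h)).classes →
      ∀ {a b}, a ∈ D → b ∈ D → h a = h b := by
    rintro D ⟨c, rfl⟩ a b ha hb
    exact (potential_eq_of_strongComponents ha).trans (potential_eq_of_strongComponents hb).symm
  constructor
  · rintro ⟨-, -, -, a, ha, b, hb, hab⟩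
    rw [hconst hB hi ha, hconst hC hj hb]
    exact hab.2
  · exact fun hl => ⟨hB, hC, hBC, i, hi, j, hj, hij, hl⟩

theorem class_disjoint {r : Setoid V} {B C : Set V} (hB : B ∈ r.classes) (hC : C ∈ r.classes)
    (hBC : B ≠ C) {i : V} (hi : i ∈ B) : i ∉ C := fun hi' =>
  hBC (Setoid.eq_of_mem_classes hB hi hC hi')

open Classical in
/-- Lifting one strong component above all of its neighbours is a flip. -/
theorem isFlip_raise {G : SimpleGraph V} {h : V → ℝ} {B : Set V} {M : ℝ}
    (hB : B ∈ (strongComponents (potentialDigraph G h)).classes)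
    (hM : ∀ i ∈ B, ∀ j ∉ B, G.Adj i j → h i < h j ∧ h j < h i + M) :
    IsFlip (potentialDigraph G h) (potentialDigraph G fun i => if i ∈ B then h i + M else h i) := by
  set k : V → ℝ := fun i => if i ∈ B then h i + M else h i
  have kB : ∀ {i}, i ∈ B → k i = h i + M := fun hi => if_pos hi
  have kB' : ∀ {i}, i ∉ B → k i = h i := fun hi => if_neg hi
  have hS : strongComponents (potentialDigraph G h) = strongComponents (potentialDigraph G k) := by
    refine strongComponents_potentialDigraph_congr fun i j hij => ?_
    by_cases hi : i ∈ B <;> by_cases hj : j ∈ B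
    · simp [kB hi, kB hj]
    · have := hM i hi j hj hij
      rw [kB hi, kB' hj]
      exact ⟨fun e => (this.1.ne e).elim, fun e => (this.2.ne' e).elim⟩
    · have := hM j hj i hi hij.symm
      rw [kB' hi, kB hj]
      exact ⟨fun e => (this.1.ne' e).elim, fun e => (this.2.ne e).elim⟩
    · simp [kB' hi, kB' hj]
  refine ⟨hS, B, hB, ?_, ?_, ?_⟩
  · rintro C ⟨hC, -, hCB, i, hi, j, hj, hij⟩
    exact hij.2.not_gt (hM j hj i (class_disjoint hC hB hCB hi) hij.1.symm).1
  · intro C D hCD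
    constructor
    · rintro ⟨hC, hD, hne, i, hi, j, hj, hij⟩
      rw [← hS] at hC hD
      refine ⟨hD, hC, hne.symm, j, hj, i, hi, hij.1.symm, ?_⟩
      rcases hCD with rfl | rfl
      · have hj' := class_disjoint hD hC hne.symm hj
        have h2 := hij.2
        rw [kB hi, kB' hj'] at h2
        exact (h2.not_gt (hM i hi j hj' hij.1).2).elim
      · have hi' := class_disjoint hC hD hne hi
        exact (hM j hj i hi' hij.1.symm).1.le
    · rintro ⟨hD, hC, hne, j, hj, i, hi, hij⟩
      refine ⟨hS ▸ hC, hS ▸ hD, hne.symm, i, hi, j, hj, hij.1.symm, ?_⟩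
      rcases hCD with rfl | rfl
      · have hj' := class_disjoint hD hC hne hj
        exact (hij.2.not_gt (hM i hi j hj' hij.1.symm).1).elim
      · have hi' := class_disjoint hC hD hne.symm hi
        rw [kB' hi', kB hj]
        exact (hM j hj i hi' hij.1).2.le
  · intro C D hC hD
    have aux : ∀ {E : Set V}, E ∈ (strongComponents (potentialDigraph G h)).classes → E ≠ B →
        ∀ {i}, i ∈ E → k i = h i := fun hE hne _ hi => kB' (class_disjoint hE hB hne hi)
    constructor
    · rintro ⟨hC', hD', hne, i, hi, j, hj, hij⟩
      rw [← hS] at hC' hD'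
      refine ⟨hC', hD', hne, i, hi, j, hj, hij.1, ?_⟩
      rw [← aux hC' hC hi, ← aux hD' hD hj]
      exact hij.2
    · rintro ⟨hC', hD', hne, i, hi, j, hj, hij⟩
      refine ⟨hS ▸ hC', hS ▸ hD', hne, i, hi, j, hj, hij.1, ?_⟩
      rw [aux hC' hC hi, aux hD' hD hj]
      exact hij.2

open Classical in
/-- Lifting an initial set of vertices above all of its neighbours is a toric equivalence. -/
theorem toricEquiv_raise [Finite V] {G : SimpleGraph V} {M : ℝ} (A : Set V) (h : V → ℝ)
    (hA : ∀ i ∈ A, ∀ j ∉ A, G.Adj i j → h i < h j)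
    (hM : ∀ i ∈ A, ∀ j, G.Adj i j → h j < h i + M) :
    toricEquiv G ⟨potentialDigraph G h, potentialDigraph_mem_Pre G h⟩
      ⟨potentialDigraph G fun i => if i ∈ A then h i + M else h i,
        potentialDigraph_mem_Pre G _⟩ := by
  induction hn : A.ncard using Nat.strong_induction_on generalizing A h with
  | _ n ih =>
  subst hn
  rcases A.eq_empty_or_nonempty with rfl | hne
  · simp
  -- The strong component `B` of a vertex of minimal potential in `A` is a source contained in `A`.
  -- It is lifted by one flip, and induction handles `A \ B`.
  obtain ⟨a, ha, hmin⟩ := Set.exists_min_image A h (Set.toFinite A) hne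
  let B : Set V := {i | strongComponents (potentialDigraph G h) i a}
  have hB : B ∈ (strongComponents (potentialDigraph G h)).classes := ⟨a, rfl⟩
  have haB : a ∈ B := Setoid.refl' (strongComponents (potentialDigraph G h)) a
  have hBh : ∀ {i}, i ∈ B → h i = h a := fun hi => potential_eq_of_strongComponents hi
  have hBA : B ⊆ A := by
    intro i hi
    have hi' := strongComponents_potentialDigraph_iff.1 hi
    clear hi
    induction hi' using ReflTransGen.head_induction_on with
    | refl => exact ha
    | head hac _ ih =>
      by_contra hn
      exact (hA _ ih _ hn hac.1.symm).ne hac.2.symm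
  have hAB : ∀ i ∈ B, ∀ j ∉ B, G.Adj i j → h i < h j := by
    intro i hi j hj hij
    by_cases hjA : j ∈ A
    · refine lt_of_le_of_ne ?_ fun e => hj (mem_of_adj_of_eq hB hi hij e)
      rw [hBh hi]
      exact hmin j hjA
    · exact hA i (hBA hi) j hjA hij
  set k : V → ℝ := fun i => if i ∈ B then h i + M else h i
  have kB : ∀ {i}, i ∈ B → k i = h i + M := fun hi => if_pos hi
  have kB' : ∀ {i}, i ∉ B → k i = h i := fun hi => if_neg hi
  have h1 : toricEquiv G ⟨potentialDigraph G h, potentialDigraph_mem_Pre G h⟩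
      ⟨potentialDigraph G k, potentialDigraph_mem_Pre G k⟩ :=
    EqvGen.rel _ _ (isFlip_raise hB fun i hi j hj hij =>
      ⟨hAB i hi j hj hij, hM i (hBA hi) j hij⟩)
  -- The hypotheses survive the lift of `B`: for neighbours in `B`, the initial-set condition
  -- follows from the old bound `hM` at the vertex of `B`, and the new bound from `hAB`.
  have h2 := ih (A \ B).ncard
    (Set.ncard_lt_ncard (hBA.sdiff_ssubset_of_nonempty ⟨a, haB⟩) (Set.toFinite A)) (A \ B) k
    (fun i hi j hj hij => by
      rw [kB' hi.2]
      by_cases hjB : j ∈ B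
      · rw [kB hjB]
        exact hM j (hBA hjB) i hij.symm
      · rw [kB' hjB]
        exact hA i hi.1 j (fun hjA => hj ⟨hjA, hjB⟩) hij)
    (fun i hi j hij => by
      rw [kB' hi.2]
      by_cases hjB : j ∈ B
      · rw [kB hjB]
        exact add_lt_add_left (hAB j hjB i hi.2 hij.symm) M
      · rw [kB' hjB]
        exact hM i hi.1 j hij) rfl
  have h3 : (fun i => if i ∈ A \ B then k i + M else k i) =
      fun i => if i ∈ A then h i + M else h i := by
    ext i
    by_cases hiB : i ∈ B
    · simp [hiB, hBA hiB, kB hiB]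
    · simp [hiB, kB' hiB]
  refine Setoid.trans' _ h1 ?_
  convert h2 using 3
  convert h3.symm

/-- A flip reverses the edges at one strong component, which is a source. -/
theorem exists_raise_of_isFlip {G : SimpleGraph V} {h k : V → ℝ}
    (hf : IsFlip (potentialDigraph G h) (potentialDigraph G k)) :
    ∃ B : Set V, (∀ i ∈ B, ∀ j ∈ B, G.Adj i j → h i = h j ∧ k i = k j) ∧
      (∀ i ∈ B, ∀ j ∉ B, G.Adj i j → h i < h j ∧ k j < k i) ∧
      (∀ i ∉ B, ∀ j ∉ B, G.Adj i j → (h i ≤ h j ↔ k i ≤ k j)) := by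
  obtain ⟨hS, B, hB, hsrc, hrev, hkeep⟩ := hf
  have cls : ∀ i, {j | strongComponents (potentialDigraph G h) j i} ∈
      (strongComponents (potentialDigraph G h)).classes := fun i => ⟨i, rfl⟩
  have self : ∀ i, i ∈ {j | strongComponents (potentialDigraph G h) j i} :=
    fun i => Setoid.refl' (strongComponents (potentialDigraph G h)) i
  have hB' := hB
  rw [hS] at hB'
  have same : ∀ i j, strongComponents (potentialDigraph G h) i j → h i = h j ∧ k i = k j := by
    intro i j hij
    refine ⟨potential_eq_of_strongComponents hij, ?_⟩
    rw [hS] at hij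
    exact potential_eq_of_strongComponents hij
  refine ⟨B, fun i hi j hj hij => ?_, fun i hi j hj hij => ?_, fun i hi j hj hij => ?_⟩
  · obtain ⟨c, rfl⟩ := hB
    exact same i j (Setoid.trans' _ hi (Setoid.symm' _ hj))
  · have hne : B ≠ {l | strongComponents (potentialDigraph G h) l j} := by
      rintro rfl
      exact hj (self j)
    have cls' := cls j
    rw [hS] at cls'
    have e1 := quotientEdge_potentialDigraph_iff (cls j) hB hne.symm (self j) hi hij.symm
    have lt1 := not_le.1 (mt e1.2 (hsrc _))
    refine ⟨lt1, ?_⟩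
    have e2 := quotientEdge_potentialDigraph_iff hB' (hS ▸ cls j) hne hi (self j) hij
    -- An edge leaving `B` after the flip would come from an edge entering the source `B` before it.
    refine not_le.1 fun hl => hsrc _ ((hrev _ _ (Or.inl rfl)).1 (e2.2 hl))
  · by_cases he : strongComponents (potentialDigraph G h) i j
    · simp [same i j he]
    have hne : {l | strongComponents (potentialDigraph G h) l i} ≠
        {l | strongComponents (potentialDigraph G h) l j} := by
      intro e
      have := self i
      rw [e] at this
      exact he this
    have hnB : ∀ l ∉ B, {m | strongComponents (potentialDigraph G h) m l} ≠ B := by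
      rintro l hl rfl
      exact hl (self l)
    rw [← quotientEdge_potentialDigraph_iff (cls i) (cls j) hne (self i) (self j) hij,
      ← quotientEdge_potentialDigraph_iff (h := k) (hS ▸ cls i) (hS ▸ cls j) hne (self i)
        (self j) hij]
    exact (hkeep _ _ (hnB i hi) (hnB j hj)).symm

end PotentialDigraph

/-! ### Representatives of points of the torus. -/

section TorusFaces

open Topology Filter

variable {V : Type*}

theorem modOne_coe (r : ℝ) : modOne (r : UnitAddCircle) = Int.fract r := by
  have := AddCircle.coe_equivIco_mk_apply (1 : ℝ) r
  rwa [div_one, mul_one] at this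

theorem modOne_mem_Ico (t : UnitAddCircle) : modOne t ∈ Ico (0 : ℝ) 1 := by
  obtain ⟨r, rfl⟩ := QuotientAddGroup.mk_surjective t
  rw [modOne_coe r]
  exact ⟨Int.fract_nonneg r, Int.fract_lt_one r⟩

theorem coe_modOne (t : UnitAddCircle) : ((modOne t : ℝ) : UnitAddCircle) = t :=
  (AddCircle.equivIco (1 : ℝ) 0).symm_apply_apply t

theorem modOne_injective : Function.Injective modOne :=
  Function.LeftInverse.injective coe_modOne

theorem modOne_coe_of_mem {r : ℝ} (hr : r ∈ Ico (0 : ℝ) 1) : modOne (r : UnitAddCircle) = r := by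
  rw [modOne_coe, Int.fract_eq_self.2 hr]

theorem coe_unitAddCircle_eq_iff {u v : ℝ} (huv : |u - v| < 1) :
    (u : UnitAddCircle) = v ↔ u = v := by
  refine ⟨fun h => ?_, fun h => h ▸ rfl⟩
  have h0 : ((u - v : ℝ) : UnitAddCircle) = 0 := by
    rw [AddCircle.coe_sub, h, sub_self]
  obtain ⟨n, hn⟩ := (AddCircle.coe_eq_zero_iff (1 : ℝ)).1 h0
  have hn' : (n : ℝ) = u - v := by simpa using hn
  rw [← hn'] at huv
  have : n = 0 := Int.abs_lt_one_iff.1 (by exact_mod_cast huv)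
  rw [this, Int.cast_zero] at hn'
  linarith

theorem toricOmega_coe {G : SimpleGraph V} {h : V → ℝ} (hh : ∀ i, h i ∈ Ico (0 : ℝ) 1) :
    toricOmega G (fun i => (h i : UnitAddCircle)) = potentialDigraph G h := by
  ext i j
  simp only [toricOmega, potentialDigraph, modOne_coe_of_mem (hh _)]

theorem toricOmega_mem_Pre [Finite V] (G : SimpleGraph V) (x : V → UnitAddCircle) :
    toricOmega G x ∈ Pre G :=
  potentialDigraph_mem_Pre G _

theorem exists_toricOmega_eq [Finite V] {G : SimpleGraph V} (τ : Pre G) :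
    ∃ x, toricOmega G x = τ.1 := by
  obtain ⟨h, hh, e⟩ := exists_potential_of_mem_Pre τ.2
  exact ⟨fun i => (h i : UnitAddCircle), by rw [e, toricOmega_coe hh]⟩

/-! ### Strata and open faces. -/

/-- The points of the torus lying on the same toric hyperplanes of `G` as `x`. -/
def toricStratum (G : SimpleGraph V) (x : V → UnitAddCircle) : Set (V → UnitAddCircle) :=
  {y | ∀ i j, G.Adj i j → (x i = x j ↔ y i = y j)}

/-- The open face containing `x`. -/
def toricFace (G : SimpleGraph V) (x : V → UnitAddCircle) : Set (V → UnitAddCircle) :=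
  connectedComponentIn (toricStratum G x) x

theorem mem_toricStratum_self (G : SimpleGraph V) (x : V → UnitAddCircle) :
    x ∈ toricStratum G x := fun _ _ _ => Iff.rfl

theorem toricStratum_eq {G : SimpleGraph V} {x y : V → UnitAddCircle}
    (hy : y ∈ toricStratum G x) : toricStratum G y = toricStratum G x := by
  ext z
  exact forall₃_congr fun i j hij => by rw [hy i j hij]

theorem toricFace_eq {G : SimpleGraph V} {x y : V → UnitAddCircle}
    (hy : y ∈ toricFace G x) : toricFace G y = toricFace G x := by
  have hy' := connectedComponentIn_subset _ _ hy
  rw [toricFace, toricStratum_eq hy']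
  exact (connectedComponentIn_eq hy).symm

theorem mem_toricFace_self (G : SimpleGraph V) (x : V → UnitAddCircle) : x ∈ toricFace G x :=
  mem_connectedComponentIn (mem_toricStratum_self G x)

/-- A point of the complement lies on exactly those hyperplanes that contain `D`, and these include
the ones defining `D`. -/
theorem flatComplement_eq_toricStratum {G : SimpleGraph V} {D : Set (V → UnitAddCircle)}
    (hD : IsFlat UnitAddCircle G D) {x : V → UnitAddCircle} (hx : x ∈ flatComplement G D) :
    flatComplement G D = toricStratum G x := by
  obtain ⟨S, hS, rfl⟩ := hD
  have key : ∀ y ∈ flatComplement G (⋂ p ∈ S, coordHyperplane UnitAddCircle p.1 p.2),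
      ∀ i j, G.Adj i j → (y i = y j ↔
        (⋂ p ∈ S, coordHyperplane UnitAddCircle p.1 p.2) ⊆ coordHyperplane UnitAddCircle i j) :=
    fun y hy i j hij => ⟨fun e => by_contra fun hn => hy.2 i j hij hn e, fun h => h hy.1⟩
  ext y
  constructor
  · exact fun hy i j hij => (key x hx i j hij).trans (key y hy i j hij).symm
  · intro hy
    refine ⟨mem_iInter₂.2 fun p hp => ?_, fun i j hij hn e => ?_⟩
    · exact (hy p.1 p.2 (hS p hp)).1 (mem_iInter₂.1 hx.1 p hp)
    · exact hx.2 i j hij hn ((hy i j hij).2 e)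

theorem toricFace_mem_toricFaces (G : SimpleGraph V) (x : V → UnitAddCircle) :
    toricFace G x ∈ toricFaces G := by
  -- All hyperplanes through `x`: their intersection is the smallest flat containing `x`.
  let S : Set (V × V) := {p | G.Adj p.1 p.2 ∧ x p.1 = x p.2}
  have hD : IsFlat UnitAddCircle G (⋂ p ∈ S, coordHyperplane UnitAddCircle p.1 p.2) :=
    ⟨S, fun p hp => hp.1, rfl⟩
  have hx : x ∈ flatComplement G (⋂ p ∈ S, coordHyperplane UnitAddCircle p.1 p.2) := by
    refine ⟨mem_iInter₂.2 fun p hp => hp.2, fun i j hij hn e => hn ?_⟩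
    exact biInter_subset_of_mem (show (i, j) ∈ S from ⟨hij, e⟩)
  exact ⟨_, hD, x, hx, by rw [flatComplement_eq_toricStratum hD hx, toricFace]⟩

theorem mem_toricFaces_iff {G : SimpleGraph V} {F : Set (V → UnitAddCircle)}
    {x : V → UnitAddCircle} : F ∈ toricFaces G ∧ x ∈ F ↔ F = toricFace G x := by
  constructor
  · rintro ⟨⟨D, hD, y, hy, rfl⟩, hx⟩
    rw [flatComplement_eq_toricStratum hD hy] at hx ⊢
    exact (toricFace_eq hx).symm
  · rintro rfl
    exact ⟨toricFace_mem_toricFaces G x, mem_toricFace_self G x⟩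

theorem exists_mem_toricFaces_iff {G : SimpleGraph V} {x y : V → UnitAddCircle} :
    (∃ F ∈ toricFaces G, x ∈ F ∧ y ∈ F) ↔ toricFace G x = toricFace G y := by
  constructor
  · rintro ⟨F, hF, hx, hy⟩
    exact (mem_toricFaces_iff.1 ⟨hF, hx⟩).symm.trans (mem_toricFaces_iff.1 ⟨hF, hy⟩)
  · intro e
    exact ⟨_, toricFace_mem_toricFaces G x, mem_toricFace_self G x, e ▸ mem_toricFace_self G y⟩

/-! ### Equivalent digraphs lie on the same face. -/

/-- A segment along which the coordinates of adjacent vertices keep coinciding or differing stays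
in one open face. -/
theorem toricFace_eq_of_segment {G : SimpleGraph V} (a b : V → ℝ)
    (hab : ∀ t ∈ Icc (0 : ℝ) 1, ∀ i j, G.Adj i j →
      ((a i : UnitAddCircle) = a j ↔
        ((a i + t * (b i - a i) : ℝ) : UnitAddCircle) = (a j + t * (b j - a j) : ℝ))) :
    toricFace G (fun i => (a i : UnitAddCircle)) = toricFace G fun i => (b i : UnitAddCircle) := by
  let f : ℝ → V → UnitAddCircle := fun t i => ((a i + t * (b i - a i) : ℝ) : UnitAddCircle)
  have hf : Continuous f := by
    refine continuous_pi fun i => (AddCircle.continuous_mk' (1 : ℝ)).comp ?_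
    fun_prop
  have h0 : f 0 = fun i => (a i : UnitAddCircle) := by
    ext i
    simp [f]
  have h1 : f 1 = fun i => (b i : UnitAddCircle) := by
    ext i
    simp [f]
  rw [← h0, ← h1]
  refine (toricFace_eq ?_).symm
  have hc : IsPreconnected (f '' Icc 0 1) := isPreconnected_Icc.image f hf.continuousOn
  refine hc.subset_connectedComponentIn (mem_image_of_mem f (left_mem_Icc.2 zero_le_one)) ?_
    (mem_image_of_mem f (right_mem_Icc.2 zero_le_one))
  rintro _ ⟨t, ht, rfl⟩
  rw [h0]
  exact hab t ht

/-- The segment stays in `[0, 1)`, where equality on the circle is equality of reals, and convex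
combinations preserve the common order on each edge. -/
theorem toricFace_eq_of_potentialDigraph_eq {G : SimpleGraph V} {a b : V → ℝ}
    (ha : ∀ i, a i ∈ Ico (0 : ℝ) 1) (hb : ∀ i, b i ∈ Ico (0 : ℝ) 1)
    (e : potentialDigraph G a = potentialDigraph G b) :
    toricFace G (fun i => (a i : UnitAddCircle)) = toricFace G fun i => (b i : UnitAddCircle) := by
  refine toricFace_eq_of_segment a b fun t ht i j hij => ?_
  have hc : ∀ l, a l + t * (b l - a l) ∈ Ico (0 : ℝ) 1 := fun l =>
    (convex_Ico (0 : ℝ) 1).add_smul_sub_mem (ha l) (hb l) ht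
  rw [coe_unitAddCircle_eq_iff (abs_sub_lt_iff.2
      ⟨by linarith [(ha i).2, (ha j).1], by linarith [(ha j).2, (ha i).1]⟩),
    coe_unitAddCircle_eq_iff (abs_sub_lt_iff.2
      ⟨by linarith [(hc i).2, (hc j).1], by linarith [(hc j).2, (hc i).1]⟩)]
  have lt : ∀ u v, G.Adj u v → a u < a v → a u + t * (b u - a u) < a v + t * (b v - a v) := by
    intro u v huv hl
    have hl' := potentialDigraph_lt e huv hl
    -- For `t < 1` strictness comes from `a`; at `t = 1` it comes from `b`.
    rcases ht.2.lt_or_eq with h1 | rfl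
    · nlinarith [mul_pos (sub_pos.2 h1) (sub_pos.2 hl), mul_nonneg ht.1 (sub_pos.2 hl').le]
    · linarith
  constructor
  · intro he
    rw [he, potentialDigraph_eq e hij he]
  · intro he
    rcases lt_trichotomy (a i) (a j) with hl | hl | hl
    · exact ((lt i j hij hl).ne he).elim
    · exact hl
    · exact ((lt j i hij.symm hl).ne' he).elim

theorem toricFace_eq_of_toricOmega_eq_coe {G : SimpleGraph V} {x : V → UnitAddCircle}
    {b : V → ℝ} (hb : ∀ i, b i ∈ Ico (0 : ℝ) 1) (e : toricOmega G x = potentialDigraph G b) :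
    toricFace G x = toricFace G fun i => (b i : UnitAddCircle) := by
  have := toricFace_eq_of_potentialDigraph_eq (fun i => modOne_mem_Ico (x i)) hb e
  simpa only [coe_modOne] using this

theorem toricFace_eq_of_toricOmega_eq {G : SimpleGraph V} {x y : V → UnitAddCircle}
    (e : toricOmega G x = toricOmega G y) : toricFace G x = toricFace G y := by
  have := toricFace_eq_of_toricOmega_eq_coe (fun i => modOne_mem_Ico (y i)) e
  simpa only [coe_modOne] using this

-- Squeeze the coordinates outside `B` into `[1/4, 1/2)` and put those in `B` at height `s`. Then `s
-- = 0` realizes `ω(x)` and `s = 3/4` realizes `ω(y)`. Moving `s` from `0` down to `-1/4`, which is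
-- `3/4` on the circle, meets no other coordinate.
open Classical in
theorem toricFace_eq_of_isFlip {G : SimpleGraph V} {x y : V → UnitAddCircle}
    (hf : IsFlip (toricOmega G x) (toricOmega G y)) : toricFace G x = toricFace G y := by
  obtain ⟨B, hBB, hBC, hCC⟩ := exists_raise_of_isFlip hf
  have ha := fun i => modOne_mem_Ico (x i)
  set a : V → ℝ := fun i => modOne (x i)
  set k : V → ℝ := fun i => modOne (y i)
  let r : ℝ → V → ℝ := fun s i => if i ∈ B then s else a i / 4 + 1 / 4
  have rB : ∀ {s i}, i ∈ B → r s i = s := fun hi => if_pos hi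
  have rC : ∀ {s i}, i ∉ B → r s i = a i / 4 + 1 / 4 := fun hi => if_neg hi
  have hr : ∀ s ∈ Ico (0 : ℝ) 1, ∀ i, r s i ∈ Ico (0 : ℝ) 1 := by
    intro s hs i
    by_cases hi : i ∈ B
    · rwa [rB hi]
    · rw [rC hi]
      constructor <;> linarith [(ha i).1, (ha i).2]
  have h0 : toricOmega G x = potentialDigraph G (r 0) := by
    refine potentialDigraph_congr (fun i j hij hl => ?_) (fun i j hij he => ?_)
    · change a i < a j at hl
      by_cases hi : i ∈ B <;> by_cases hj : j ∈ B
      · exact (hl.ne (hBB i hi j hj hij).1).elim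
      · rw [rB hi, rC hj]
        linarith [(ha j).1]
      · exact (hl.not_gt (hBC j hj i hi hij.symm).1).elim
      · rw [rC hi, rC hj]
        linarith
    · change a i = a j at he
      by_cases hi : i ∈ B <;> by_cases hj : j ∈ B
      · rw [rB hi, rB hj]
      · exact ((hBC i hi j hj hij).1.ne he).elim
      · exact ((hBC j hj i hi hij.symm).1.ne' he).elim
      · rw [rC hi, rC hj, he]
  have h1 : potentialDigraph G (r (3 / 4)) = toricOmega G y := by
    refine potentialDigraph_congr (fun i j hij hl => ?_) (fun i j hij he => ?_)
    · change k i < k j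
      by_cases hi : i ∈ B <;> by_cases hj : j ∈ B
      · rw [rB hi, rB hj] at hl
        exact (lt_irrefl _ hl).elim
      · rw [rB hi, rC hj] at hl
        linarith [(ha j).2]
      · exact (hBC j hj i hi hij.symm).2
      · rw [rC hi, rC hj] at hl
        refine not_le.1 fun hk => ?_
        have : a j ≤ a i := (hCC j hj i hi hij.symm).2 hk
        linarith
    · change k i = k j
      by_cases hi : i ∈ B <;> by_cases hj : j ∈ B
      · exact (hBB i hi j hj hij).2
      · rw [rB hi, rC hj] at he
        linarith [(ha j).2]
      · rw [rC hi, rB hj] at he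
        linarith [(ha i).2]
      · rw [rC hi, rC hj] at he
        have he' : a i = a j := by linarith
        exact ((hCC i hi j hj hij).1 he'.le).antisymm ((hCC j hj i hi hij.symm).1 he'.ge)
  have hs : (fun i => (r (-1 / 4) i : UnitAddCircle)) = fun i => (r (3 / 4) i : UnitAddCircle) := by
    ext i
    by_cases hi : i ∈ B
    · rw [rB hi, rB hi, show (3 / 4 : ℝ) = -1 / 4 + 1 by norm_num]
      exact (AddCircle.coe_add_period (1 : ℝ) _).symm
    · rw [rC hi, rC hi]
  have hm : toricFace G (fun i => (r 0 i : UnitAddCircle)) =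
      toricFace G fun i => (r (-1 / 4) i : UnitAddCircle) := by
    -- A coordinate outside `B` exceeds one in `B` by at least `1/4` and less than `3/4` throughout,
    -- so the two never agree modulo `1`.
    refine toricFace_eq_of_segment _ _ fun t ht i j hij => ?_
    by_cases hi : i ∈ B <;> by_cases hj : j ∈ B
    · simp only [rB hi, rB hj]
    · simp only [rB hi, rC hj]
      have := ha j
      rw [coe_unitAddCircle_eq_iff, coe_unitAddCircle_eq_iff]
      · constructor <;> intro he <;> linarith [this.1, ht.1]
      all_goals rw [abs_sub_lt_iff]; constructor <;> linarith [this.1, this.2, ht.1, ht.2]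
    · simp only [rC hi, rB hj]
      have := ha i
      rw [coe_unitAddCircle_eq_iff, coe_unitAddCircle_eq_iff]
      · constructor <;> intro he <;> linarith [this.1, ht.1]
      all_goals rw [abs_sub_lt_iff]; constructor <;> linarith [this.1, this.2, ht.1, ht.2]
    · simp only [rC hi, rC hj, sub_self, mul_zero, add_zero]
  rw [toricFace_eq_of_toricOmega_eq_coe (hr 0 (by norm_num)) h0, hm, hs]
  exact (toricFace_eq_of_toricOmega_eq_coe (hr (3 / 4) (by norm_num)) h1.symm).symm

/-- Transitivity needs a point of the torus above the intermediate digraph; `exists_toricOmega_eq`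
supplies it. -/
theorem toricFace_eq_of_toricEquiv [Finite V] {G : SimpleGraph V} {τ τ' : Pre G}
    (h : toricEquiv G τ τ') : ∀ x y, toricOmega G x = τ.1 → toricOmega G y = τ'.1 →
      toricFace G x = toricFace G y := by
  induction h with
  | rel τ τ' hf =>
    intro x y hx hy
    exact toricFace_eq_of_isFlip (by rwa [hx, hy])
  | refl τ => exact fun x y hx hy => toricFace_eq_of_toricOmega_eq (hx.trans hy.symm)
  | symm _ _ _ ih => exact fun x y hx hy => (ih y x hy hx).symm
  | trans _ τ _ _ _ ih ih' =>
    intro x y hx hy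
    obtain ⟨z, hz⟩ := exists_toricOmega_eq τ
    exact (ih x z hx hz).trans (ih' z y hz hy)

/-! ### Points of one face have equivalent digraphs. -/

/-- A point of the circle near the image of `a` is the image of a real number near `a`. -/
theorem eventually_exists_near_lift (t : UnitAddCircle) {ε : ℝ} (hε : 0 < ε) :
    ∀ᶠ u in 𝓝 t, ∃ r : ℝ, |r - modOne t| < ε ∧ (r : UnitAddCircle) = u := by
  have h := (QuotientAddGroup.isOpenMap_coe (N := AddSubgroup.zmultiples (1 : ℝ))).image_mem_nhds
    (Metric.ball_mem_nhds (modOne t) hε)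
  rw [show ((modOne t : ℝ) : ℝ ⧸ AddSubgroup.zmultiples (1 : ℝ)) = t from coe_modOne t] at h
  filter_upwards [h] with u hu
  obtain ⟨r, hr, e⟩ := hu
  exact ⟨r, by simpa [Real.dist_eq] using hr, e⟩

open Classical in
/-- Nearby points of the same stratum have equivalent digraphs. -/
theorem eventually_toricEquiv [Finite V] (G : SimpleGraph V) (x : V → UnitAddCircle) :
    ∀ᶠ y in 𝓝[toricStratum G x] x,
      toricEquiv G ⟨toricOmega G x, toricOmega_mem_Pre G x⟩
        ⟨toricOmega G y, toricOmega_mem_Pre G y⟩ := by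
  have ha := fun i => modOne_mem_Ico (x i)
  set a : V → ℝ := fun i => modOne (x i)
  -- Moves by less than `ε` keep lifts below `1`, keep positive coordinates positive and keep
  -- distinct coordinates in order; the factor `2` lets both ends of an edge move.
  have hεex : ∀ᶠ ε in 𝓝[>] (0 : ℝ), (∀ i, 2 * ε < 1 - a i) ∧ (∀ i, 0 < a i → ε < a i) ∧
      ∀ i j, a i < a j → 2 * ε < a j - a i := by
    have aux : ∀ c : ℝ, 0 < c → ∀ᶠ ε in 𝓝[>] (0 : ℝ), 2 * ε < c := by
      intro c hc
      filter_upwards [Ioo_mem_nhdsGT (half_pos hc)] with ε hε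
      linarith [hε.2]
    refine (eventually_all.2 fun i => aux _ (sub_pos.2 (ha i).2)).and
      ((eventually_all.2 fun i => ?_).and (eventually_all.2 fun i => eventually_all.2 fun j => ?_))
    · by_cases hi : 0 < a i
      · filter_upwards [Ioo_mem_nhdsGT hi] with ε hε _ using hε.2
      · exact Eventually.of_forall fun _ h => (hi h).elim
    · by_cases hij : a i < a j
      · filter_upwards [aux _ (sub_pos.2 hij)] with ε hε _ using hε
      · exact Eventually.of_forall fun _ h => (hij h).elim
  obtain ⟨ε, ⟨h1, h2, h3⟩, hε⟩ := (hεex.and self_mem_nhdsWithin).exists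
  have hε : 0 < ε := hε
  have hnear : ∀ᶠ y in 𝓝 x, ∀ i, ∃ r : ℝ, |r - a i| < ε ∧ (r : UnitAddCircle) = y i :=
    eventually_all.2 fun i =>
      (continuous_apply i).continuousAt.eventually (eventually_exists_near_lift (x i) hε)
  filter_upwards [nhdsWithin_le_nhds hnear, self_mem_nhdsWithin] with y hy hyS
  choose r hr hry using hy
  -- The coordinates that cross `0` downwards: they start at `0`, and their representative becomes
  -- `r i + 1`.
  let A : Set V := {i | r i < 0}
  have hA0 : ∀ i ∈ A, a i = 0 := by
    intro i hi
    have hi : r i < 0 := hi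
    by_contra hne
    have := h2 i (lt_of_le_of_ne (ha i).1 (Ne.symm hne))
    linarith [(abs_sub_lt_iff.1 (hr i)).2]
  have hxa : ∀ i j, a i = a j ↔ x i = x j := fun i j => modOne_injective.eq_iff
  have hb : ∀ i, modOne (y i) = if i ∈ A then r i + 1 else r i := by
    intro i
    have hri := abs_sub_lt_iff.1 (hr i)
    split_ifs with hi
    · have hi' : r i < 0 := hi
      rw [← hry i, ← AddCircle.coe_add_period (1 : ℝ) (r i)]
      refine modOne_coe_of_mem ⟨?_, by linarith⟩
      linarith [hA0 i hi, h1 i]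
    · have hi' : 0 ≤ r i := not_lt.1 hi
      rw [← hry i]
      exact modOne_coe_of_mem ⟨hi', by linarith [h1 i]⟩
  have hyx : ∀ i j, G.Adj i j → (modOne (y i) = modOne (y j) ↔ a i = a j) := fun i j hij =>
    modOne_injective.eq_iff.trans ((hyS i j hij).symm.trans (hxa i j).symm)
  -- Within a stratum equal adjacent coordinates stay equal, so they cannot be separated by
  -- wrapping. Hence `A` is initial.
  have hAadj : ∀ i ∈ A, ∀ j ∉ A, G.Adj i j → a i < a j := by
    intro i hi j hj hij
    refine lt_of_le_of_ne ((hA0 i hi).trans_le (ha j).1) fun e => ?_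
    have e' := (hyx i j hij).2 e
    rw [hb i, hb j, if_pos hi, if_neg hj] at e'
    have := hA0 i hi
    linarith [(abs_sub_lt_iff.1 (hr i)).2, (abs_sub_lt_iff.1 (hr j)).1, h1 i]
  have hraise := toricEquiv_raise A a hAadj (M := 1) fun i hi j _ => by
    linarith [(ha j).2, hA0 i hi]
  have e : (potentialDigraph G fun i => if i ∈ A then a i + 1 else a i) = toricOmega G y := by
    refine potentialDigraph_congr (fun i j hij hl => ?_) (fun i j hij he => ?_)
    · simp only [hb]
      have hri := abs_sub_lt_iff.1 (hr i)
      have hrj := abs_sub_lt_iff.1 (hr j)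
      split_ifs at hl ⊢ with hi hj hj
      · linarith [hA0 i hi, hA0 j hj]
      · linarith [hA0 i hi, (ha j).2]
      · linarith [hA0 j hj, h1 i]
      · linarith [h3 i j hl]
    · refine (hyx i j hij).2 ?_
      split_ifs at he with hi hj hj
      · linarith
      · linarith [hA0 i hi, (ha j).2]
      · linarith [hA0 j hj, (ha i).2]
      · exact he
  have e' : (⟨toricOmega G y, toricOmega_mem_Pre G y⟩ : Pre G) =
      ⟨_, potentialDigraph_mem_Pre G fun i => if i ∈ A then a i + 1 else a i⟩ := Subtype.ext e.symm
  rw [e']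
  exact hraise

/-- With the discrete topology on the quotient, the locally constant class map is continuous on the
stratum, hence constant on its connected components. -/
theorem toricEquiv_of_toricFace_eq [Finite V] {G : SimpleGraph V} {x y : V → UnitAddCircle}
    (h : toricFace G x = toricFace G y) :
    toricEquiv G ⟨toricOmega G x, toricOmega_mem_Pre G x⟩
      ⟨toricOmega G y, toricOmega_mem_Pre G y⟩ := by
  let _ : TopologicalSpace (Quotient (toricEquiv G)) := ⊥
  have : DiscreteTopology (Quotient (toricEquiv G)) := ⟨rfl⟩
  let f : (V → UnitAddCircle) → Quotient (toricEquiv G) := fun z =>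
    Quotient.mk (toricEquiv G) ⟨toricOmega G z, toricOmega_mem_Pre G z⟩
  have hf : ContinuousOn f (toricStratum G x) := by
    intro z hz
    have hev : f =ᶠ[𝓝[toricStratum G x] z] fun _ => f z := by
      rw [← toricStratum_eq hz]
      filter_upwards [eventually_toricEquiv G z] with w hw
      exact (Quotient.sound hw).symm
    exact continuousWithinAt_const.congr_of_eventuallyEq hev rfl
  have hy : y ∈ toricFace G x := h ▸ mem_toricFace_self G y
  exact Quotient.exact (isPreconnected_connectedComponentIn.constant
    (hf.mono (connectedComponentIn_subset _ _)) (mem_toricFace_self G x) hy)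

theorem toricEquiv_toricOmega_iff [Finite V] {G : SimpleGraph V} {x y : V → UnitAddCircle} :
    toricEquiv G ⟨toricOmega G x, toricOmega_mem_Pre G x⟩
      ⟨toricOmega G y, toricOmega_mem_Pre G y⟩ ↔ toricFace G x = toricFace G y :=
  ⟨fun h => toricFace_eq_of_toricEquiv h x y rfl rfl, toricEquiv_of_toricFace_eq⟩

theorem nonempty_of_mem_toricFaces {G : SimpleGraph V} {F : Set (V → UnitAddCircle)}
    (hF : F ∈ toricFaces G) : F.Nonempty := by
  obtain ⟨D, -, x, hx, rfl⟩ := hF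
  exact ⟨x, mem_connectedComponentIn hx⟩

end TorusFaces

theorem proposition4p5 {V : Type*} [Finite V] (G : SimpleGraph V) :
    ∃ hα : ∀ x : V → UnitAddCircle, toricOmega G x ∈ Pre G,
      (∀ x : V → UnitAddCircle, ∃! F, F ∈ toricFaces G ∧ x ∈ F) ∧
      (∃ Φ : toricFaces G → Quotient (toricEquiv G), Function.Bijective Φ ∧
        ∀ (F : toricFaces G) (x : V → UnitAddCircle), x ∈ F.1 →
          Φ F = Quotient.mk (toricEquiv G) ⟨toricOmega G x, hα x⟩) ∧
      (∀ x x' : V → UnitAddCircle,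
        toricEquiv G ⟨toricOmega G x, hα x⟩ ⟨toricOmega G x', hα x'⟩ ↔
          ∃ F ∈ toricFaces G, x ∈ F ∧ x' ∈ F) := by
  refine ⟨toricOmega_mem_Pre G, fun x => ?_, ?_, fun x x' => ?_⟩
  · exact ⟨toricFace G x, mem_toricFaces_iff.2 rfl, fun F hF => mem_toricFaces_iff.1 hF⟩
  · choose p hp using fun F : toricFaces G => nonempty_of_mem_toricFaces F.2
    have hpF : ∀ F : toricFaces G, F.1 = toricFace G (p F) := fun F =>
      mem_toricFaces_iff.1 ⟨F.2, hp F⟩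
    refine ⟨fun F => Quotient.mk (toricEquiv G) ⟨toricOmega G (p F), toricOmega_mem_Pre G (p F)⟩,
      ⟨fun F F' h => ?_, fun q => ?_⟩, fun F x hx => ?_⟩
    · apply Subtype.ext
      rw [hpF F, hpF F']
      exact toricEquiv_toricOmega_iff.1 (Quotient.exact h)
    · induction q using Quotient.inductionOn with
      | _ τ =>
      obtain ⟨x, hx⟩ := exists_toricOmega_eq τ
      have hτ : τ = ⟨toricOmega G x, toricOmega_mem_Pre G x⟩ := Subtype.ext hx.symm
      refine ⟨⟨toricFace G x, toricFace_mem_toricFaces G x⟩, ?_⟩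
      rw [hτ]
      exact Quotient.sound (toricEquiv_toricOmega_iff.2 (hpF ⟨_, _⟩).symm)
    · exact Quotient.sound (toricEquiv_toricOmega_iff.2
        ((hpF F).symm.trans (mem_toricFaces_iff.1 ⟨F.2, hx⟩)))
  · rw [toricEquiv_toricOmega_iff, exists_mem_toricFaces_iff]
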